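/- All rings are commutative and Noetherian. For a local ring $(S,\mathfrak n,k)$ and an ideal $I\subseteq S$, the Burch ideal is $\mathrm{BI}_S(I)=I\mathfrak n:(I:\mathfrak n)$. The relative Burch index $\mathrm{Burch}_S(I)$ is $0$ if $I=0$ or $\operatorname{depth} S/I>0$, and $\dim_k \mathfrak n/\mathrm{BI}_S(I)$ otherwise. A regular presentation $R=S/I$ of a local ring $(R,\mathfrak m)$ is a surjective local homomorphism $S\to R$ with kernel $I$, where $S$ is a regular local ring; it is minimal if $\dim_k\mathfrak n/\mathfrak n^2=\dim_k\mathfrak m/\mathfrak m^2$. Theorem 1.3. Let $R$ be a local ring of depth $0$. (1) Let $R=S/I$ be a regular presentation. The ideal $\mathrm{BI}_S(I)R$ of $R$ does not depend on the presentation. If $R$ is not a field, then the number $\mathrm{Burch}_S(I)$ does not depend on the presentation either. (2) Let $\widehat R$ be the $\mathfrak m$-adic completion of $R$, and let $\widehat R=S/I$ be a minimal regular presentation. The ideal $\mathrm{BI}(R)=\mathrm{BI}_S(I)\widehat R\cap R$, that is, the preimage of $\mathrm{BI}_S(I)\widehat R$ in $R$, and the number $\mathrm{Burch}(R)=\mathrm{Burch}_S(I)$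 do not depend on the choice of the minimal regular presentation of $\widehat R$. In this sense the Burch index of $R$ is well defined (also when $R$ is a field). -/

import Mathlib

open IsLocalRing

/-- The depth of a module `M` over a local ring `A`: the supremum of the lengths of the `M`-regular
sequences in the maximal ideal of `A`. The depth of the ring `A` is `localDepth A A`. -/
noncomputable def localDepth (A : Type*) [CommRing A] [IsLocalRing A]
    (M : Type*) [AddCommGroup M] [Module A M] : ℕ∞ :=
  ⨆ (rs : List A) (_ : RingTheory.Sequence.IsRegular M rs ∧ ∀ x ∈ rs, x ∈ maximalIdeal A),
    (rs.length : ℕ∞)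

/-- The Burch ideal `I𝔫 : (I : 𝔫)` of an ideal `I` of a local ring `(S, 𝔫)`. -/
noncomputable def burchIdeal {S : Type*} [CommRing S] [IsLocalRing S] (I : Ideal S) : Ideal S :=
  (I * maximalIdeal S).colon ((I.colon (maximalIdeal S : Set S) : Ideal S) : Set S)

theorem mul_mem_burchIdeal {S : Type*} [CommRing S] [IsLocalRing S] (I : Ideal S)
    {a b : S} (ha : a ∈ maximalIdeal S) (hb : b ∈ maximalIdeal S) :
    a * b ∈ burchIdeal I := by
  refine Submodule.mem_colon.mpr fun s hs => ?_
  have h : s * b ∈ I := Submodule.mem_colon.mp hs b hb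
  have e : (a * b) • s = (s * b) * a := by rw [smul_eq_mul]; ring
  rw [e]
  exact Ideal.mul_mem_mul h ha

/-- The quotient `𝔫 / BI_S(I)` (more precisely `𝔫 / (BI_S(I) ∩ 𝔫)`; the Burch ideal is contained
in `𝔫` when `S/I` has depth `0`). -/
abbrev BurchQuotient {S : Type*} [CommRing S] [IsLocalRing S] (I : Ideal S) : Type _ :=
  (maximalIdeal S) ⧸ Submodule.comap (maximalIdeal S).subtype (burchIdeal I)

theorem burchQuotient_isTorsionBySet {S : Type*} [CommRing S] [IsLocalRing S] (I : Ideal S) :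
    Module.IsTorsionBySet S (BurchQuotient I) (maximalIdeal S : Set S) := by
  rintro x ⟨a, ha⟩
  obtain ⟨y, rfl⟩ := Submodule.Quotient.mk_surjective _ x
  change a • Submodule.Quotient.mk y = 0
  rw [← Submodule.Quotient.mk_smul, Submodule.Quotient.mk_eq_zero]
  exact mul_mem_burchIdeal I ha y.2

/-- `𝔫 / BI_S(I)` is a vector space over the residue field: the class of `s` acts as `s`. -/
noncomputable instance burchQuotientModule {S : Type*} [CommRing S] [IsLocalRing S]
    (I : Ideal S) : Module (ResidueField S) (BurchQuotient I) :=
  (burchQuotient_isTorsionBySet I).module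

theorem burchQuotient_residue_smul {S : Type*} [CommRing S] [IsLocalRing S] (I : Ideal S)
    (s : S) (x : BurchQuotient I) : residue S s • x = s • x :=
  rfl

open Classical in
/-- The relative Burch index `Burch_S(I)`: zero if `I = 0` or `S/I` has positive depth, and
`dim_k (𝔫 / BI_S(I))` otherwise, where `k` is the residue field of the Noetherian local ring
`(S, 𝔫)`. -/
noncomputable def burchIndex {S : Type*} [CommRing S] [IsLocalRing S] [IsNoetherianRing S]
    (I : Ideal S) : ℕ :=
  if I = ⊥ ∨ 0 < localDepth S (S ⧸ I) then 0
  else Module.finrank (ResidueField S) (BurchQuotient I)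

/-- A regular presentation of a local ring `R`: a surjective local homomorphism from a regular
local ring `S` to `R`. It exhibits `R` as `S/I` with `I = ker f`. -/
structure IsRegularPresentation {S R : Type*} [CommRing S] [IsRegularLocalRing S]
    [CommRing R] [IsLocalRing R] (f : S →+* R) : Prop where
  surjective : Function.Surjective f
  isLocalHom : IsLocalHom f

/-- A regular presentation is minimal if `S` and `R` have the same embedding dimension:
`dim 𝔫/𝔫² = dim 𝔪/𝔪²`. -/
structure IsMinimalRegularPresentation {S R : Type*} [CommRing S] [IsRegularLocalRing S]
    [CommRing R] [IsLocalRing R] (f : S →+* R) : Prop extends IsRegularPresentation f where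
  finrank_eq : Module.finrank (ResidueField S) (CotangentSpace S) =
    Module.finrank (ResidueField R) (CotangentSpace R)

/-! Two presentations are compared directly, without a third one dominating both. Depth 0 enters
only through a nonzero socle element of `R`; it puts the Burch ideal inside `𝔫`. Take `a = ∑ cᵢxᵢ`
in the Burch ideal of `I₁`, with `xᵢ` minimal generators of `𝔫₁`, and lift the images of `cᵢ`, `xᵢ`
to `cᵢ'`, `yᵢ` in `S₂`. If `u'` lies in `I₂ : 𝔫₂` and `u` has the same image in `R`, then `au = ∑
bᵢxᵢ` with `bᵢ ∈ I₁`, so `∑ (ucᵢ - bᵢ)xᵢ = 0`. Such relations come from Koszul relations, hence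
lift: `u' ∑ cᵢ'yᵢ ∈ I₂𝔫₂` (`sum_mul_mem_of_sum_mul_eq_zero`). Thus `∑ cᵢ'yᵢ` is in the Burch ideal
of `I₂`, and symmetry gives equality in `R`.

If `R` is not a field, `I` lies in its Burch ideal, so the index can be read off in `R`. For a
field, `I = 𝔫` has Burch ideal `𝔫²` and index `dim S`; minimality then forces index 0. -/

/-! ### Regular local rings and their regular parameters -/

/-- A finite set of elements of the maximal ideal of `S` that generates it together with the kernel
of a surjection `S → T` bounds the number of generators of the maximal ideal of `T`. -/
theorem spanFinrank_maximalIdeal_le_card_of_surjective {S T : Type*} [CommRing S] [IsLocalRing S]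
    [CommRing T] [IsLocalRing T] (f : S →+* T) (hf : Function.Surjective f) (u : Finset S)
    (hu : (u : Set S) ⊆ maximalIdeal S)
    (h : maximalIdeal S ≤ Ideal.span (u : Set S) ⊔ RingHom.ker f) :
    (maximalIdeal T).spanFinrank ≤ u.card := by
  classical
  have heq : maximalIdeal T = Ideal.span ((u.image f : Finset T) : Set T) := by
    rw [Finset.coe_image, ← Ideal.map_span, ← IsLocalRing.map_maximalIdeal_of_surjective f hf]
    refine le_antisymm ((Ideal.map_mono h).trans ?_) (Ideal.map_mono (Ideal.span_le.mpr hu))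
    rw [Ideal.map_sup, (Ideal.map_eq_bot_iff_le_ker f).mpr le_rfl, sup_bot_eq]
  rw [heq]
  refine (Submodule.spanFinrank_span_le_ncard_of_finite (Finset.finite_toSet _)).trans ?_
  rw [Set.ncard_coe_finset]
  exact Finset.card_image_le

theorem le_of_natCast_add_le_add_natCast {a : ℕ} {b : WithBot ℕ∞} {n : ℕ}
    (h : (a : WithBot ℕ∞) + n ≤ b + n) : (a : WithBot ℕ∞) ≤ b := by
  induction b using WithBot.recBotCoe with
  | bot =>
    rw [WithBot.bot_add, ← Nat.cast_add] at h
    exact absurd (le_bot_iff.mp h) (by simp)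
  | coe b =>
    have h' : (a : ℕ∞) + n ≤ b + n := by exact_mod_cast h
    exact_mod_cast (ENat.add_le_add_iff_right (ENat.natCast_ne_top n)).mp h'

/-- A Noetherian local ring whose maximal ideal is generated by at most `dim S` elements is a
domain. -/
theorem isDomain_of_spanFinrank_le (d : ℕ) (S : Type*) [CommRing S] [IsLocalRing S]
    [IsNoetherianRing S] (h₁ : (maximalIdeal S).spanFinrank ≤ d)
    (h₂ : (d : WithBot ℕ∞) ≤ ringKrullDim S) : IsDomain S := by
  induction d generalizing S with
  | zero =>
    have h : maximalIdeal S = ⊥ :=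
      (Submodule.spanFinrank_eq_zero_iff_eq_bot
        (maximalIdeal S).fg_of_isNoetherianRing).mp (Nat.le_zero.mp h₁)
    exact (IsLocalRing.isField_iff_maximalIdeal_eq.mpr h).isDomain
  | succ d ih =>
    have hne : ¬ maximalIdeal S ≤ maximalIdeal S ^ 2 := by
      intro h
      have h0 : maximalIdeal S = ⊥ :=
        Submodule.eq_bot_of_le_smul_of_le_jacobson_bot (maximalIdeal S) _
          (maximalIdeal S).fg_of_isNoetherianRing (by rwa [smul_eq_mul, ← sq])
          (IsLocalRing.maximalIdeal_le_jacobson _)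
      have := ringKrullDim_eq_zero_of_isField (IsLocalRing.isField_iff_maximalIdeal_eq.mpr h0)
      rw [this] at h₂
      exact absurd h₂ (by norm_cast)
    have hmin : ∀ p ∈ minimalPrimes S, ¬ maximalIdeal S ≤ p := by
      intro p hp h
      have hp' : p.IsPrime := hp.1.1
      have e : p = maximalIdeal S := le_antisymm (IsLocalRing.le_maximalIdeal hp'.ne_top) h
      have h0 : ringKrullDim S = 0 := by
        rw [← IsLocalRing.maximalIdeal_height_eq_ringKrullDim, ← e,
          Ideal.height_eq_zero_iff.mpr hp]
        rfl
      rw [h0] at h₂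
      exact absurd h₂ (by norm_cast)
    -- Prime avoidance; the square of the maximal ideal fills the slots allowed to be non-prime.
    obtain ⟨x, hxm, hx2, hxp⟩ : ∃ x ∈ maximalIdeal S, x ∉ maximalIdeal S ^ 2 ∧
        ∀ p ∈ minimalPrimes S, x ∉ p := by
      by_contra! hcon
      have hfin : (insert (maximalIdeal S ^ 2) (minimalPrimes S)).Finite :=
        (minimalPrimes.finite_of_isNoetherianRing S).insert _
      have := (Ideal.subset_union_prime_finite hfin (f := id) (maximalIdeal S ^ 2)
        (maximalIdeal S ^ 2) (I := maximalIdeal S) (by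
          rintro p (rfl | hp) h _
          · exact absurd rfl h
          · exact hp.1.1)).mp (by
          intro x hx
          by_cases hx2 : x ∈ maximalIdeal S ^ 2
          · exact Set.mem_biUnion (Set.mem_insert _ _) hx2
          · obtain ⟨p, hp, hxp⟩ := hcon x hx hx2
            exact Set.mem_biUnion (Set.mem_insert_of_mem _ hp) hxp)
      obtain ⟨p, (rfl | hp), hle⟩ := this
      · exact hne hle
      · exact hmin p hp hle
    have hxtop : Ideal.span {x} ≠ ⊤ := by
      rw [Ne, Ideal.span_singleton_eq_top]; exact hxm
    have : Nontrivial (S ⧸ Ideal.span {x}) := Ideal.Quotient.nontrivial_iff.mpr hxtop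
    have : IsLocalRing (S ⧸ Ideal.span {x}) :=
      .of_surjective' (Ideal.Quotient.mk _) Ideal.Quotient.mk_surjective
    have hdom : IsDomain (S ⧸ Ideal.span {x}) := by
      refine ih _ ?_ ?_
      · classical
        obtain ⟨s, hs, hspan⟩ := Submodule.FG.exists_span_finset_card_eq_spanFinrank
          (maximalIdeal S).fg_of_isNoetherianRing
        have hx' : x ∈ Ideal.span (s : Set S) := by
          rw [Ideal.span, hspan]; exact hxm
        obtain ⟨c, hc⟩ := Submodule.mem_span_finset.mp hx'
        have hsm : ∀ i ∈ s, i ∈ maximalIdeal S := fun i hi => by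
          rw [← hspan]; exact Submodule.subset_span hi
        -- As `x` avoids the square, some coefficient is a unit; `x` can replace that generator.
        obtain ⟨i, hi, hci⟩ : ∃ i ∈ s, c i ∉ maximalIdeal S := by
          by_contra! hcon
          refine hx2 ?_
          rw [← hc.2, sq]
          exact sum_mem fun i hi => Ideal.mul_mem_mul (hcon i hi) (hsm i hi)
        refine (spanFinrank_maximalIdeal_le_card_of_surjective (Ideal.Quotient.mk (Ideal.span {x}))
          Ideal.Quotient.mk_surjective (s.erase i)
          (fun k hk => hsm k (Finset.mem_of_mem_erase hk)) ?_).trans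
          (by rw [Finset.card_erase_of_mem hi]; omega)
        rw [Ideal.mk_ker, ← hspan]
        change Ideal.span (s : Set S) ≤ _
        rw [Ideal.span_le]
        intro j hj
        by_cases hji : j = i
        · subst hji
          have hu : IsUnit (c j) := by simpa using hci
          refine (Ideal.unit_mul_mem_iff_mem _ hu).mp ?_
          have : c j * j = x - ∑ k ∈ s.erase j, c k * k := by
            rw [← hc.2, ← Finset.add_sum_erase s _ hi]; simp
          rw [this]
          refine sub_mem (Ideal.mem_sup_right (Ideal.mem_span_singleton_self x))
            (Ideal.mem_sup_left (sum_mem fun k hk => ?_))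
          exact Ideal.mul_mem_left _ _ (Ideal.subset_span hk)
        · exact Ideal.mem_sup_left (Ideal.subset_span (Finset.mem_erase.mpr ⟨hji, hj⟩))
      · have h := ringKrullDim_le_ringKrullDim_quotient_add_encard ({x} : Set S) (by
          rw [IsLocalRing.ringJacobson_eq_maximalIdeal]; simpa using hxm)
        rw [Set.encard_singleton] at h
        have h3 := h₂.trans h
        push_cast at h3
        exact le_of_natCast_add_le_add_natCast (n := 1) (by exact_mod_cast h3)
    have hprime : (Ideal.span {x}).IsPrime := (Ideal.Quotient.isDomain_iff_prime _).mp hdom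
    obtain ⟨p, hp, hpx⟩ := Ideal.exists_minimalPrimes_le (J := Ideal.span {x}) (bot_le (a := _))
    have hp' : p.IsPrime := hp.1.1
    have hxp := hxp p hp
    -- Since `p ⊆ (x)` and `x ∉ p`, one has `p = xp`, and Nakayama applies.
    have hp0 : p = ⊥ := by
      refine Submodule.eq_bot_of_le_smul_of_le_jacobson_bot (maximalIdeal S) _
          p.fg_of_isNoetherianRing (fun y hy => ?_) (IsLocalRing.maximalIdeal_le_jacobson _)
      obtain ⟨z, rfl⟩ := Ideal.mem_span_singleton.mp (hpx hy)
      exact Ideal.mul_mem_mul hxm ((hp'.mem_or_mem hy).resolve_left hxp)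
    rw [hp0] at hp'
    exact IsDomain.of_bot_isPrime S

instance IsRegularLocalRing.isDomain (S : Type*) [CommRing S] [IsRegularLocalRing S] :
    IsDomain S :=
  isDomain_of_spanFinrank_le _ S le_rfl IsRegularLocalRing.spanFinrank_maximalIdeal.le

/-- The ideals generated by parts of a minimal system of generators of the maximal ideal of a
regular local ring are prime. -/
theorem IsRegularLocalRing.isPrime_span_of_subset {S : Type*} [CommRing S] [IsRegularLocalRing S]
    {s t : Finset S} (hs : Ideal.span (s : Set S) = maximalIdeal S)
    (hcard : s.card = (maximalIdeal S).spanFinrank) (hts : t ⊆ s) :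
    (Ideal.span (t : Set S)).IsPrime := by
  classical
  have htm : Ideal.span (t : Set S) ≤ maximalIdeal S := hs ▸ Ideal.span_mono (by exact_mod_cast hts)
  have htop : Ideal.span (t : Set S) ≠ ⊤ := fun h =>
    (maximalIdeal.isMaximal S).ne_top (top_le_iff.mp (h ▸ htm))
  have : Nontrivial (S ⧸ Ideal.span (t : Set S)) := Ideal.Quotient.nontrivial_iff.mpr htop
  have : IsLocalRing (S ⧸ Ideal.span (t : Set S)) :=
    .of_surjective' (Ideal.Quotient.mk _) Ideal.Quotient.mk_surjective
  rw [← Ideal.Quotient.isDomain_iff_prime]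
  refine isDomain_of_spanFinrank_le (s \ t).card _ ?_ ?_
  · refine spanFinrank_maximalIdeal_le_card_of_surjective _ Ideal.Quotient.mk_surjective _
      (fun k hk => hs ▸ Ideal.subset_span (Finset.mem_sdiff.mp hk).1) ?_
    rw [Ideal.mk_ker, ← Ideal.span_union, ← Finset.coe_union, Finset.sdiff_union_of_subset hts, hs]
  · have h := ringKrullDim_le_ringKrullDim_quotient_add_card t (by
      rw [IsLocalRing.ringJacobson_eq_maximalIdeal]
      exact Ideal.span_le.mp htm)
    rw [← IsRegularLocalRing.spanFinrank_maximalIdeal, ← hcard,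
      ← Finset.card_sdiff_add_card_eq_card hts] at h
    push_cast at h
    exact le_of_natCast_add_le_add_natCast h

/-- Otherwise `a` could be dropped, leaving fewer generators than the minimal number. -/
theorem IsRegularLocalRing.notMem_span_of_subset {S : Type*} [CommRing S] [IsRegularLocalRing S]
    {s t : Finset S} (hs : Ideal.span (s : Set S) = maximalIdeal S)
    (hcard : s.card = (maximalIdeal S).spanFinrank) (hts : t ⊆ s) {a : S} (ha : a ∈ s)
    (hat : a ∉ t) : a ∉ Ideal.span (t : Set S) := by
  classical
  intro h
  have heq : maximalIdeal S = Ideal.span ((s.erase a : Finset S) : Set S) := by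
    rw [← hs]
    refine le_antisymm (Ideal.span_le.mpr fun j hj => ?_)
      (Ideal.span_mono (by exact_mod_cast Finset.erase_subset a s))
    by_cases hja : j = a
    · subst hja
      exact Ideal.span_mono (fun k hk => Finset.mem_erase.mpr
        ⟨fun e => hat (by rwa [← e]), hts hk⟩) h
    · exact Ideal.subset_span (Finset.mem_erase.mpr ⟨hja, hj⟩)
  have h1 := Submodule.spanFinrank_span_le_ncard_of_finite (R := S)
    (Finset.finite_toSet (s.erase a))
  rw [← Ideal.span, ← heq, Set.ncard_coe_finset, ← hcard, Finset.card_erase_of_mem ha] at h1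
  have := Finset.card_pos.mpr ⟨a, ha⟩
  omega

/-! ### Comparison of Burch ideals -/

/-- Linear relations between minimal generators of the maximal ideal of a regular local ring `S₁`
are consequences of the Koszul relations; so they persist modulo `ker f₂ * 𝔫₂` after lifting along
a homomorphism `f₂ : S₂ → R` from another local ring. -/
theorem sum_mul_mem_of_sum_mul_eq_zero {R S₁ S₂ : Type*} [CommRing R] [CommRing S₁]
    [IsRegularLocalRing S₁] [CommRing S₂] [IsLocalRing S₂] {f₁ : S₁ →+* R} {f₂ : S₂ →+* R}
    (hf₂ : Function.Surjective f₂)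
    {s t : Finset S₁} (hs : Ideal.span (s : Set S₁) = maximalIdeal S₁)
    (hcard : s.card = (maximalIdeal S₁).spanFinrank) (hts : t ⊆ s)
    {y : S₁ → S₂} (hy : ∀ i, f₂ (y i) = f₁ i) (hyn : ∀ i ∈ s, y i ∈ maximalIdeal S₂)
    (c : S₁ → S₁) (c' : S₁ → S₂) (hc : ∀ i, f₂ (c' i) = f₁ (c i))
    (h : ∑ i ∈ t, c i * i = 0) :
    ∑ i ∈ t, c' i * y i ∈ RingHom.ker f₂ * maximalIdeal S₂ := by
  classical
  induction t using Finset.induction_on generalizing c c' with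
  | empty => simp
  | insert a t hat ih =>
    have hts' : t ⊆ s := (Finset.subset_insert a t).trans hts
    have ha : a ∈ s := hts (Finset.mem_insert_self a t)
    rw [Finset.sum_insert hat] at h ⊢
    have hca : c a ∈ Ideal.span (t : Set S₁) := by
      have hmem : c a * a ∈ Ideal.span (t : Set S₁) := by
        rw [eq_neg_of_add_eq_zero_left h]
        exact neg_mem (sum_mem fun i hi => Ideal.mul_mem_left _ _ (Ideal.subset_span hi))
      exact ((IsRegularLocalRing.isPrime_span_of_subset hs hcard hts').mem_or_mem
        hmem).resolve_right (IsRegularLocalRing.notMem_span_of_subset hs hcard hts' ha hat)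
    obtain ⟨d, hd⟩ := Submodule.mem_span_finset.mp hca
    choose d' hd' using fun i => hf₂ (f₁ (d i))
    -- Substituting `c a = ∑ d i * i` moves the `a`-term into the other coefficients.
    have h1 := ih hts' (fun i => c i + d i * a) (fun i => c' i + d' i * y a)
      (fun i => by simp [hc, hd', hy]) (by
        rw [← h, ← hd.2]
        simp only [smul_eq_mul, Finset.sum_mul, ← Finset.sum_add_distrib]
        exact Finset.sum_congr rfl fun i _ => by ring)
    -- The lifted substitution holds only modulo `ker f₂`; the error is multiplied by `y a ∈ 𝔫₂`,
    -- hence is harmless.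
    have h2 : (c' a - ∑ i ∈ t, d' i * y i) * y a ∈ RingHom.ker f₂ * maximalIdeal S₂ := by
      refine Ideal.mul_mem_mul ?_ (hyn a ha)
      rw [RingHom.mem_ker, map_sub, map_sum, hc, ← hd.2, map_sum, sub_eq_zero]
      exact Finset.sum_congr rfl fun i _ => by simp [hd', hy]
    have h3 := add_mem h2 h1
    convert h3 using 1
    rw [sub_mul, Finset.sum_mul]
    simp only [add_mul, Finset.sum_add_distrib]
    have : ∑ i ∈ t, d' i * y a * y i = ∑ i ∈ t, d' i * y i * y a :=
      Finset.sum_congr rfl fun i _ => by ring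
    rw [this]
    ring

/-- The Burch ideal is proper if `S/I` has a nonzero socle. -/
theorem burchIdeal_ker_le_maximalIdeal {R S : Type*} [CommRing R] [IsLocalRing R] [CommRing S]
    [IsLocalRing S] {f : S →+* R} (hf : Function.Surjective f) [IsLocalHom f]
    (hR : ∃ s : R, s ≠ 0 ∧ ∀ x ∈ maximalIdeal R, s * x = 0) :
    burchIdeal (RingHom.ker f) ≤ maximalIdeal S := by
  obtain ⟨s, hs0, hs⟩ := hR
  obtain ⟨s, rfl⟩ := hf s
  refine IsLocalRing.le_maximalIdeal fun htop => hs0 ?_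
  have h1 : (1 : S) ∈ burchIdeal (RingHom.ker f) := (Ideal.eq_top_iff_one _).mp htop
  have hsc : s ∈ (RingHom.ker f).colon (maximalIdeal S : Set S) := by
    refine Submodule.mem_colon.mpr fun x hx => ?_
    rw [smul_eq_mul, RingHom.mem_ker, map_mul]
    exact hs _ (IsLocalRing.map_maximalIdeal_le f (Ideal.mem_map_of_mem f hx))
  have := Submodule.mem_colon.mp h1 s hsc
  rw [one_smul] at this
  have hker : RingHom.ker f * maximalIdeal S ≤ RingHom.ker f := Ideal.mul_le_left
  exact RingHom.mem_ker.mp (hker this)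

theorem map_burchIdeal_ker_le {R S₁ S₂ : Type*} [CommRing R] [IsLocalRing R] [CommRing S₁]
    [IsRegularLocalRing S₁] [CommRing S₂] [IsLocalRing S₂] {f₁ : S₁ →+* R} {f₂ : S₂ →+* R}
    (hf₁ : Function.Surjective f₁) [IsLocalHom f₁] (hf₂ : Function.Surjective f₂) [IsLocalHom f₂]
    (hR : ∃ s : R, s ≠ 0 ∧ ∀ x ∈ maximalIdeal R, s * x = 0) :
    (burchIdeal (RingHom.ker f₁)).map f₁ ≤ (burchIdeal (RingHom.ker f₂)).map f₂ := by
  refine Ideal.map_le_iff_le_comap.mpr fun a ha => ?_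
  obtain ⟨s, hcard, hs⟩ := Submodule.FG.exists_span_finset_card_eq_spanFinrank
    (maximalIdeal S₁).fg_of_isNoetherianRing
  change Ideal.span (s : Set S₁) = _ at hs
  have han := burchIdeal_ker_le_maximalIdeal hf₁ hR ha
  obtain ⟨c, hc⟩ := Submodule.mem_span_finset.mp (hs.symm ▸ han)
  choose g hg using fun i => hf₂ (f₁ i)
  have hgn : ∀ i ∈ s, g i ∈ maximalIdeal S₂ := fun i hi hu => by
    have hi' : i ∈ maximalIdeal S₁ := hs ▸ Ideal.subset_span hi
    have h1 := hu.map f₂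
    rw [hg] at h1
    exact hi' ((isUnit_map_iff f₁ i).mp h1)
  have hfa : f₁ a = f₂ (∑ i ∈ s, g (c i) * g i) := by
    rw [← hc.2, map_sum, map_sum]
    exact Finset.sum_congr rfl fun i _ => by simp [hg]
  rw [Ideal.mem_comap, hfa]
  refine Ideal.mem_map_of_mem f₂ (Submodule.mem_colon.mpr fun u' hu' => ?_)
  obtain ⟨u, hu⟩ := hf₁ (f₂ u')
  have huc : u ∈ (RingHom.ker f₁).colon (maximalIdeal S₁ : Set S₁) := by
    refine Submodule.mem_colon.mpr fun x hx => ?_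
    have hgx : g x ∈ maximalIdeal S₂ := fun hv => by
      have h1 := hv.map f₂
      rw [hg] at h1
      exact hx ((isUnit_map_iff f₁ x).mp h1)
    have := Submodule.mem_colon.mp hu' (g x) hgx
    rw [smul_eq_mul, RingHom.mem_ker, map_mul] at this ⊢
    rw [hu, ← hg x, this]
  have hau := Submodule.mem_colon.mp ha u huc
  obtain ⟨b, hb⟩ : ∃ b : S₁ → S₁, (∀ i, b i ∈ RingHom.ker f₁) ∧ a * u = ∑ i ∈ s, b i * i := by
    rw [← smul_eq_mul]
    refine Submodule.mul_induction_on hau (fun x hx z hz => ?_) ?_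
    · obtain ⟨e, he⟩ := Submodule.mem_span_finset.mp (hs.symm ▸ hz)
      refine ⟨fun i => x * e i, fun i => Ideal.mul_mem_right _ _ hx, ?_⟩
      rw [← he.2, Finset.mul_sum]
      exact Finset.sum_congr rfl fun i _ => by rw [smul_eq_mul]; ring
    · rintro x z ⟨b, hb, rfl⟩ ⟨b', hb', rfl⟩
      exact ⟨fun i => b i + b' i, fun i => add_mem (hb i) (hb' i), by
        simp only [add_mul, Finset.sum_add_distrib]⟩
  -- The `b i` vanish in `R`, so `u' * g (c i)` is a lift of the whole coefficient.
  have key := sum_mul_mem_of_sum_mul_eq_zero hf₂ hs hcard subset_rfl hg hgn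
    (fun i => u * c i - b i) (fun i => u' * g (c i)) (fun i => by
      rw [map_mul, map_sub, map_mul, hg, hu, RingHom.mem_ker.mp (hb.1 i), sub_zero]) (by
      simp only [sub_mul, Finset.sum_sub_distrib]
      rw [← hb.2, sub_eq_zero, ← hc.2, Finset.sum_mul]
      exact Finset.sum_congr rfl fun i _ => by rw [smul_eq_mul]; ring)
  convert key using 1
  rw [smul_eq_mul, Finset.sum_mul]
  exact Finset.sum_congr rfl fun i _ => by ring

/-! ### Depth zero and the socle -/

theorem exists_socle_of_localDepth_eq_zero {R : Type*} [CommRing R] [IsLocalRing R]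
    [IsNoetherianRing R] (hR : localDepth R R = 0) :
    ∃ s : R, s ≠ 0 ∧ ∀ x ∈ maximalIdeal R, s * x = 0 := by
  have hno : ∀ x ∈ maximalIdeal R, ¬ IsSMulRegular R x := by
    intro x hx hreg
    have hmem : ∀ r ∈ [x], r ∈ maximalIdeal R := by simpa using hx
    have h1 : RingTheory.Sequence.IsRegular R [x] :=
      (IsLocalRing.isRegular_iff_isWeaklyRegular_of_subset_maximalIdeal hmem).mpr
        ((RingTheory.Sequence.isWeaklyRegular_singleton_iff R x).mpr hreg)
    have h2 : (([x] : List R).length : ℕ∞) ≤ localDepth R R :=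
      le_iSup₂ (f := fun (rs : List R) (_ : RingTheory.Sequence.IsRegular R rs ∧
        ∀ x ∈ rs, x ∈ maximalIdeal R) => (rs.length : ℕ∞)) [x] ⟨h1, hmem⟩
    rw [hR] at h2
    simp at h2
  -- All non-units are zero divisors, so they lie in the union of the finitely many associated
  -- primes.
  obtain ⟨p, hp, hle⟩ : ∃ p ∈ associatedPrimes R R, maximalIdeal R ≤ p := by
    refine (Ideal.subset_union_prime_finite (associatedPrimes.finite R R) (f := id) ⊥ ⊥
      fun p hp _ _ => IsAssociatedPrime.isPrime hp).mp ?_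
    simp only [id]
    rw [biUnion_associatedPrimes_eq_compl_regular R R]
    exact hno
  have hpp := IsAssociatedPrime.isPrime hp
  obtain ⟨_, s, hs⟩ := isAssociatedPrime_iff.mp hp
  refine ⟨s, fun h0 => hpp.ne_top (hs.trans ?_), fun x hx => ?_⟩
  · rw [h0]
    exact eq_top_iff.mpr fun r _ => Submodule.mem_colon_singleton.mpr (by simp)
  · have hxs := hle hx
    rw [hs] at hxs
    simpa [mul_comm] using Submodule.mem_colon_singleton.mp hxs

/-! ### The Burch index -/

theorem burchIndex_eq_finrank {R S : Type*} [CommRing R] [IsLocalRing R] [CommRing S]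
    [IsRegularLocalRing S] {f : S →+* R} (hf : Function.Surjective f) [IsLocalHom f]
    (hR : ∃ s : R, s ≠ 0 ∧ ∀ x ∈ maximalIdeal R, s * x = 0) (hfield : ¬ IsField R) :
    burchIndex (RingHom.ker f) =
      Module.finrank (ResidueField S) (BurchQuotient (RingHom.ker f)) := by
  obtain ⟨s, hs0, hs⟩ := hR
  obtain ⟨s, rfl⟩ := hf s
  have hsx : ∀ x ∈ maximalIdeal S, f (x * s) = 0 := fun x hx => by
    rw [map_mul, mul_comm]
    exact hs _ (IsLocalRing.map_maximalIdeal_le f (Ideal.mem_map_of_mem f hx))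
  refine if_neg ?_
  rintro (h | h)
  -- If the kernel is zero, `R` is a domain, and a nonzero socle element forces a field.
  · obtain ⟨x, hx, hx0⟩ : ∃ x ∈ maximalIdeal S, x ≠ 0 := by
      refine Submodule.exists_mem_ne_zero_of_ne_bot fun hbot => hfield ?_
      have hinj : Function.Injective f := (RingHom.injective_iff_ker_eq_bot f).mpr h
      exact (RingEquiv.ofBijective f ⟨hinj, hf⟩).symm.toMulEquiv.isField
        (IsLocalRing.isField_iff_maximalIdeal_eq.mpr hbot)
    have h1 : x * s ∈ RingHom.ker f := hsx x hx
    rw [h, Ideal.mem_bot] at h1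
    exact hs0 (by rw [(mul_eq_zero.mp h1).resolve_left hx0, map_zero])
  -- The first element of a regular sequence would kill the class of `s`.
  · obtain ⟨rs, hrs⟩ := lt_iSup_iff.mp h
    obtain ⟨⟨hreg, hmem⟩, hlen⟩ := lt_iSup_iff.mp hrs
    match rs with
    | [] => simp at hlen
    | r :: rs =>
      have h1 := ((RingTheory.Sequence.isRegular_cons_iff _ r rs).mp hreg).1
      have h2 : r • (Ideal.Quotient.mk (RingHom.ker f) s) = r • 0 := by
        rw [smul_zero, Algebra.smul_def, Ideal.Quotient.algebraMap_eq, ← map_mul]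
        exact Ideal.Quotient.eq_zero_iff_mem.mpr (hsx r (hmem r (by simp)))
      exact hs0 (RingHom.mem_ker.mp (Ideal.Quotient.eq_zero_iff_mem.mp (h1 h2)))

/-- A unit in `I : 𝔫` would give `𝔫 ⊆ I` and make `R` a field; hence `I : 𝔫 ⊆ 𝔫`. -/
theorem ker_le_burchIdeal {R S : Type*} [CommRing R] [IsLocalRing R] [CommRing S]
    [IsLocalRing S] {f : S →+* R} (hf : Function.Surjective f) (hfield : ¬ IsField R) :
    RingHom.ker f ≤ burchIdeal (RingHom.ker f) := by
  refine fun a ha => Submodule.mem_colon.mpr fun u hu => Ideal.mul_mem_mul ha ?_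
  by_contra hun
  have hu' : IsUnit u := by simpa using hun
  refine hfield (IsLocalRing.isField_iff_maximalIdeal_eq.mpr (le_bot_iff.mp fun x hx => ?_))
  obtain ⟨x, rfl⟩ := hf x
  have hx' : x ∈ maximalIdeal S := fun h => hx (h.map f)
  exact RingHom.mem_ker.mp
    ((Ideal.unit_mul_mem_iff_mem _ hu').mp (Submodule.mem_colon.mp hu x hx'))

/-- The number `dim 𝔫 / BI_S(I)` is determined by the image of the Burch ideal in `R = S/I`. -/
theorem finrank_burchQuotient_ker {R S : Type*} [CommRing R] [IsLocalRing R] [CommRing S]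
    [IsLocalRing S] {f : S →+* R} (hf : Function.Surjective f) [IsLocalHom f]
    (hfield : ¬ IsField R) {J : Ideal R} (hJ : (burchIdeal (RingHom.ker f)).map f = J)
    (h : Module.IsTorsionBySet R
      (maximalIdeal R ⧸ Submodule.comap (maximalIdeal R).subtype J)
      (maximalIdeal R : Set R)) :
    Module.finrank (ResidueField S) (BurchQuotient (RingHom.ker f)) =
      @Module.finrank (ResidueField R)
        (maximalIdeal R ⧸ Submodule.comap (maximalIdeal R).subtype J) _ _ h.module := by
  let : Module (ResidueField R) (maximalIdeal R ⧸ Submodule.comap (maximalIdeal R).subtype J) :=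
    h.module
  have hmem : ∀ a : S, a ∈ burchIdeal (RingHom.ker f) ↔ f a ∈ J := fun a => by
    rw [← hJ, ← Ideal.mem_comap, Ideal.comap_map_of_surjective' f hf,
      sup_eq_left.mpr (ker_le_burchIdeal hf hfield)]
  have hloc : ∀ a ∈ maximalIdeal S, f a ∈ maximalIdeal R := fun a ha hu =>
    ha ((isUnit_map_iff f a).mp hu)
  let g : maximalIdeal S →ₛₗ[f] maximalIdeal R :=
    { toFun := fun a => ⟨f (a : S), hloc a a.2⟩
      map_add' := fun a b => Subtype.ext (map_add f (a : S) b)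
      map_smul' := fun r a => Subtype.ext (map_mul f r (a : S)) }
  let φ : BurchQuotient (RingHom.ker f) →ₛₗ[f]
      (maximalIdeal R ⧸ Submodule.comap (maximalIdeal R).subtype J) :=
    Submodule.mapQ _ _ g fun a ha => (hmem a).mp ha
  have hφ : Function.Bijective φ := by
    constructor
    · refine (injective_iff_map_eq_zero φ).mpr fun x hx => ?_
      obtain ⟨a, rfl⟩ := Submodule.Quotient.mk_surjective _ x
      exact (Submodule.Quotient.mk_eq_zero _).mpr
        ((hmem a).mpr ((Submodule.Quotient.mk_eq_zero
          (Submodule.comap (maximalIdeal R).subtype J) (x := g a)).mp hx))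
    · intro y
      obtain ⟨⟨b, hb⟩, rfl⟩ := Submodule.Quotient.mk_surjective _ y
      obtain ⟨a, rfl⟩ := hf b
      exact ⟨Submodule.Quotient.mk ⟨a, fun hu => hb (hu.map f)⟩, rfl⟩
  have hi : Function.Bijective (ResidueField.map f) := by
    refine ⟨RingHom.injective _, fun y => ?_⟩
    obtain ⟨r, rfl⟩ := residue_surjective y
    obtain ⟨a, rfl⟩ := hf r
    exact ⟨residue S a, ResidueField.map_residue f a⟩
  -- The bijection is semilinear over the isomorphism of residue fields.
  have hrank := lift_rank_eq_of_equiv_equiv (ResidueField.map f)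
    (AddEquiv.ofBijective φ.toAddMonoidHom hφ) hi (by
      intro r x
      obtain ⟨a, rfl⟩ := residue_surjective r
      exact φ.map_smulₛₗ a x)
  have htoNat := congrArg Cardinal.toNat hrank
  rwa [Cardinal.toNat_lift, Cardinal.toNat_lift] at htoNat

theorem burchIndex_ker_eq {R S₁ S₂ : Type*} [CommRing R] [IsLocalRing R] [CommRing S₁]
    [IsRegularLocalRing S₁] [CommRing S₂] [IsRegularLocalRing S₂] {f₁ : S₁ →+* R} {f₂ : S₂ →+* R}
    (h₁ : IsRegularPresentation f₁) (h₂ : IsRegularPresentation f₂)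
    (hR : ∃ s : R, s ≠ 0 ∧ ∀ x ∈ maximalIdeal R, s * x = 0) :
    (burchIdeal (RingHom.ker f₁)).map f₁ = (burchIdeal (RingHom.ker f₂)).map f₂ ∧
      (¬ IsField R → burchIndex (RingHom.ker f₁) = burchIndex (RingHom.ker f₂)) := by
  have := h₁.isLocalHom
  have := h₂.isLocalHom
  have heq : (burchIdeal (RingHom.ker f₁)).map f₁ = (burchIdeal (RingHom.ker f₂)).map f₂ :=
    le_antisymm (map_burchIdeal_ker_le h₁.surjective h₂.surjective hR)
      (map_burchIdeal_ker_le h₂.surjective h₁.surjective hR)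
  refine ⟨heq, fun hfield => ?_⟩
  have h : Module.IsTorsionBySet R
      (maximalIdeal R ⧸ Submodule.comap (maximalIdeal R).subtype
        ((burchIdeal (RingHom.ker f₂)).map f₂)) (maximalIdeal R : Set R) := by
    rintro x ⟨a, ha⟩
    obtain ⟨⟨y, hy⟩, rfl⟩ := Submodule.Quotient.mk_surjective _ x
    replace ha : a ∈ maximalIdeal R := ha
    refine (Submodule.Quotient.mk_eq_zero _).mpr ?_
    change a * y ∈ (burchIdeal (RingHom.ker f₂)).map f₂
    obtain ⟨a, rfl⟩ := h₂.surjective a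
    obtain ⟨y, rfl⟩ := h₂.surjective y
    rw [← map_mul]
    have ha' : a ∈ maximalIdeal S₂ := fun hu => ha (hu.map f₂)
    have hy' : y ∈ maximalIdeal S₂ := fun hu => hy (hu.map f₂)
    exact Ideal.mem_map_of_mem f₂ (mul_mem_burchIdeal _ ha' hy')
  rw [burchIndex_eq_finrank h₁.surjective hR hfield, burchIndex_eq_finrank h₂.surjective hR hfield,
    finrank_burchQuotient_ker h₁.surjective hfield heq h,
    finrank_burchQuotient_ker h₂.surjective hfield rfl h]

theorem burchIndex_ker_eq_zero_of_isField {R S : Type*} [CommRing R] [IsLocalRing R] [CommRing S]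
    [IsRegularLocalRing S] {f : S →+* R} (h : IsMinimalRegularPresentation f) (hR : IsField R) :
    burchIndex (RingHom.ker f) = 0 := by
  let := hR.toField
  have hS : IsField S := by
    rw [← IsLocalRing.finrank_cotangentSpace_eq_zero_iff, h.finrank_eq,
      IsLocalRing.finrank_cotangentSpace_eq_zero_iff]
    exact hR
  let := hS.toField
  exact if_pos (Or.inl ((RingHom.injective_iff_ker_eq_bot f).mp f.injective))

/-! ### Passage to the completion -/

/-- A socle element survives because `R` embeds in its completion, whose maximal ideal is extended
from `R`. -/
theorem AdicCompletion.exists_socle {R : Type*} [CommRing R] [IsLocalRing R] [IsNoetherianRing R]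
    (hR : ∃ s : R, s ≠ 0 ∧ ∀ x ∈ maximalIdeal R, s * x = 0) :
    ∃ s : AdicCompletion (maximalIdeal R) R, s ≠ 0 ∧
      ∀ x ∈ maximalIdeal (AdicCompletion (maximalIdeal R) R), s * x = 0 := by
  obtain ⟨s, hs0, hs⟩ := hR
  refine ⟨algebraMap R _ s, fun h => hs0 ?_, fun x hx => ?_⟩
  · exact AdicCompletion.of_injective (maximalIdeal R) R (h.trans (_root_.map_zero (algebraMap R _)).symm)
  · rw [AdicCompletion.maximalIdeal_eq_map] at hx
    refine Submodule.span_induction ?_ (mul_zero _) (fun y z _ _ hy hz => ?_) (fun r y _ hy => ?_) hx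
    · rintro _ ⟨y, hy, rfl⟩
      rw [← map_mul, hs y hy, _root_.map_zero]
    · rw [mul_add, hy, hz, add_zero]
    · rw [smul_eq_mul, mul_left_comm, hy, mul_zero]

theorem theorem1p3 {R : Type*} [CommRing R] [IsLocalRing R] [IsNoetherianRing R]
    (hR : localDepth R R = 0) :
    -- independence of the regular presentation of `R`
    (∀ {S₁ : Type*} {S₂ : Type*} [CommRing S₁] [IsRegularLocalRing S₁]
        [CommRing S₂] [IsRegularLocalRing S₂] (f₁ : S₁ →+* R) (f₂ : S₂ →+* R),
        IsRegularPresentation f₁ → IsRegularPresentation f₂ →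
        (burchIdeal (RingHom.ker f₁)).map f₁ = (burchIdeal (RingHom.ker f₂)).map f₂ ∧
        (¬ IsField R → burchIndex (RingHom.ker f₁) = burchIndex (RingHom.ker f₂))) ∧
    -- the Burch ideal and the Burch index of `R`, read off from a minimal regular presentation of
    -- the completion of `R`, do not depend on that presentation
    (∀ {S₁ : Type*} {S₂ : Type*} [CommRing S₁] [IsRegularLocalRing S₁]
        [CommRing S₂] [IsRegularLocalRing S₂]
        (f₁ : S₁ →+* AdicCompletion (maximalIdeal R) R)
        (f₂ : S₂ →+* AdicCompletion (maximalIdeal R) R),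
        IsMinimalRegularPresentation f₁ → IsMinimalRegularPresentation f₂ →
        ((burchIdeal (RingHom.ker f₁)).map f₁).comap
            (algebraMap R (AdicCompletion (maximalIdeal R) R)) =
          ((burchIdeal (RingHom.ker f₂)).map f₂).comap
            (algebraMap R (AdicCompletion (maximalIdeal R) R)) ∧
        burchIndex (RingHom.ker f₁) = burchIndex (RingHom.ker f₂)) := by
  have hsoc := exists_socle_of_localDepth_eq_zero hR
  refine ⟨fun f₁ f₂ h₁ h₂ => burchIndex_ker_eq h₁ h₂ hsoc, fun f₁ f₂ h₁ h₂ => ?_⟩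
  obtain ⟨hideal, hindex⟩ := burchIndex_ker_eq h₁.toIsRegularPresentation
    h₂.toIsRegularPresentation (AdicCompletion.exists_socle hsoc)
  refine ⟨by rw [hideal], ?_⟩
  by_cases hfield : IsField (AdicCompletion (maximalIdeal R) R)
  · rw [burchIndex_ker_eq_zero_of_isField h₁ hfield, burchIndex_ker_eq_zero_of_isField h₂ hfield]
  · exact hindex hfield
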